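/- A \emph{coin set} is a set of positive integers containing $1$. A \emph{representation} of a positive integer $N$ in a coin set $\mathcal{C}$ is a finite collection of elements of $\mathcal{C}$ (repetitions allowed) with sum $N$; $\mathrm{opt}(N;\mathcal{C})$ is the least number of elements in a representation of $N$, and $\mathrm{cost}(N;\mathcal{C}) = \sum_{k=1}^{N} \mathrm{opt}(k;\mathcal{C})$. A coin set is \emph{greedy} if, for every positive integer, successively choosing the greatest coin not exceeding the remaining amount gives a representation with the least possible number of coins. A coin set is \emph{completely greedy} if every subset of it containing $1$ is greedy, and an infinite coin set $\{c_1 < c_2 < \cdots\}$ is called completely greedy if $\{c_1,\dots,c_n\}$ is completely greedy for every $n \ge 1$. Let $\mathcal{C} = \{c_{1} < c_{2} < \cdots\}$ be an infinite completely greedy coin set. For $n \ge 1$ write $c_{n+1} = q_{n} c_{n} + r_{n}$ with integers $q_n$ and $0 \le r_{n} < c_{n}$, and let $a_{n} = \lceil c_{n+1}/c_{n} \rceil$. Let $s_{n} = \sum_{k=1}^{n} (b_{k} - 1)$, where $b_{1} = a_{1} = q_{1}$ and, for $n \ge 2$, recursively, $$b_{n} = \begin{cases} a_{n} & \text{if }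 q_{n} \le s_{n-1}, \\ q_{n} & \text{otherwise.} \end{cases}$$ Then, as $n \to \infty$, $$\mathrm{cost}(c_{n+1} - 1;\mathcal{C}) \ge \frac{s_{n}}{2}\, c_{n+1} + o(n c_{n+1}),$$ that is, there is a real sequence $(g_n)$ with $g_n = o(n c_{n+1})$ as $n \to \infty$ (for the fixed set $\mathcal{C}$) such that $\mathrm{cost}(c_{n+1} - 1;\mathcal{C}) \ge \frac{s_{n}}{2} c_{n+1} + g_n$ for all $n \ge 1$. Moreover, for all $n \ge 1$, $$s_{n} \ge \max \{ n, \log_{2} c_{n+1} - 1 \}.$$ -/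

import Mathlib

open Filter Asymptotics

namespace CoinSet

/-- A coin set is a set of positive integers containing `1`. -/
def IsCoinSet (C : Set ℕ) : Prop :=
  1 ∈ C ∧ ∀ c ∈ C, 0 < c

/-- `m` is a representation of `N` in `C`: a finite collection (multiset) of coins of `C`
with sum `N`. -/
def IsRep (C : Set ℕ) (N : ℕ) (m : Multiset ℕ) : Prop :=
  (∀ c ∈ m, c ∈ C) ∧ m.sum = N

/-- A representation is minimal if it uses the least possible number of coins. -/
def IsMinimalRep (C : Set ℕ) (N : ℕ) (m : Multiset ℕ) : Prop :=
  IsRep C N m ∧ ∀ m' : Multiset ℕ, IsRep C N m' → m.card ≤ m'.card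

/-- The optimal cost: the number of coins in a minimal representation of `N`. -/
noncomputable def opt (C : Set ℕ) (N : ℕ) : ℕ :=
  sInf {k | ∃ m : Multiset ℕ, IsRep C N m ∧ m.card = k}

open Classical in
/-- The greatest coin of `C` that is at most `N` (and `0` if there is none). -/
noncomputable def greatestCoin (C : Set ℕ) (N : ℕ) : ℕ :=
  Nat.findGreatest (fun c => c ∈ C) N

open Classical in
theorem greatestCoin_le (C : Set ℕ) (N : ℕ) : greatestCoin C N ≤ N := by
  unfold greatestCoin
  exact Nat.findGreatest_le N

/-- The greedy representation of `N`: successively choose the greatest coin that is at most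
the amount that remains. -/
noncomputable def greedyRep (C : Set ℕ) (N : ℕ) : Multiset ℕ :=
  if 0 < greatestCoin C N then
    greatestCoin C N ::ₘ greedyRep C (N - greatestCoin C N)
  else 0
termination_by N
decreasing_by
  have := greatestCoin_le C N
  omega

/-- A coin set is greedy if the greedy representation of every positive integer is minimal. -/
def IsGreedy (C : Set ℕ) : Prop :=
  ∀ N : ℕ, 0 < N → IsMinimalRep C N (greedyRep C N)

/-- A coin set is completely greedy if all of its sub-coin sets are greedy. -/
def IsCompletelyGreedy (C : Set ℕ) : Prop :=
  ∀ D : Set ℕ, D ⊆ C → IsCoinSet D → IsGreedy D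

/-- `coin C k` is the `k`-th element `c_k` of an infinite set `C` in increasing order, counted
from `k = 1`. -/
noncomputable def coin (C : Set ℕ) (k : ℕ) : ℕ :=
  Nat.nth (fun c => c ∈ C) (k - 1)

/-- An infinite coin set is completely greedy if its first `n` terms `{c_1, …, c_n}` form a
completely greedy coin set, for every `n ≥ 1`. -/
def IsInfiniteCompletelyGreedy (C : Set ℕ) : Prop :=
  IsCoinSet C ∧ C.Infinite ∧ ∀ n : ℕ, 1 ≤ n → IsCompletelyGreedy (coin C '' Set.Icc 1 n)

/-- The total cost of the transactions `1, …, N`. -/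
noncomputable def cost (C : Set ℕ) (N : ℕ) : ℕ :=
  ∑ k ∈ Finset.Icc 1 N, opt C k

/-- The quotient `q_n` in the division `c_{n+1} = q_n c_n + r_n`, `0 ≤ r_n < c_n`. -/
noncomputable def q (C : Set ℕ) (n : ℕ) : ℤ :=
  (coin C (n + 1) : ℤ) / (coin C n : ℤ)

/-- The ceiling `a_n` of `c_{n+1} / c_n`. -/
noncomputable def a (C : Set ℕ) (n : ℕ) : ℤ :=
  ⌈(coin C (n + 1) : ℝ) / (coin C n : ℝ)⌉

/-- The value of `b_n` when `S` is the value of `s_{n-1}`. -/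
noncomputable def bOf (C : Set ℕ) (n : ℕ) (S : ℤ) : ℤ :=
  if n = 1 then a C 1 else if q C n ≤ S then a C n else q C n

/-- The sums `s_n = ∑_{k=1}^n (b_k - 1)`, by recursion together with the `b_k`;
see `s_eq_sum`. -/
noncomputable def s (C : Set ℕ) : ℕ → ℤ
  | 0 => 0
  | n + 1 => s C n + (bOf C (n + 1) (s C n) - 1)

/-- `b_1 = a_1` and, for `n ≥ 2`, `b_n = a_n` if `q_n ≤ s_{n-1}` and `b_n = q_n` otherwise. -/
noncomputable def b (C : Set ℕ) (n : ℕ) : ℤ :=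
  bOf C n (s C (n - 1))

theorem s_eq_sum (C : Set ℕ) (n : ℕ) : s C n = ∑ k ∈ Finset.Icc 1 n, (b C k - 1) := by
  induction n with
  | zero => simp [s]
  | succ n ih => rw [Finset.sum_Icc_succ_top (by omega), ← ih]; simp [s, b]

end CoinSet

/-!
Write `c_n` for `coin C n`. Complete greediness enters in two ways only.

* Greediness of `{c_1, …, c_n}` gives `opt (N + c_n) = opt N + 1` as long as `N + c_n < c_{n+1}`
  (`opt_add_coin`). Hence `F N = ∑_{k < N} opt k`, which is `cost (N - 1)`, satisfies
  `F (m c_n + t) = m F (c_n) + c_n m (m - 1) / 2 + m t + F t` (`totalOpt_block`).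
* Greediness of `{1, c_n, c_{n+1}}`, tested at `(q_n + 1) c_n`, shows that if `c_n ∤ c_{n+1}` then
  the defect `δ_n = (q_n + 1) c_n - c_{n+1}` is at most `q_n` (`coin_defect_le`). In particular
  `3 c_n ≤ 2 c_{n+1}`, so the coins grow geometrically.

The lower bound is then an induction on `n` (`totalOpt_lower_bound`). If `b_n = q_n` (so that
`r_n = 0` or `q_n > s_{n-1}`), the block formula passes the bound `F (c_n) ≥ (s_{n-1} / 2 - D) c_n`
on to `n` without any loss. If `b_n = q_n + 1`, the incomplete last block lacks only
`δ_n ≤ q_n ≤ s_{n-1}` terms, and restoring them costs at most `δ_n (q_n + M)`, where `M` bounds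
`opt` below `c_n`. With `T_n = ∑_{k < n} c_{k+1} / c_k`, both `s_{n-1}` and `M` are at most `T_n`,
so the loss relative to `c_{n+1}` is at most `2 T_n / c_n`. This tends to zero because the coins
grow geometrically, and therefore the accumulated loss is `o(n)` by taking Cesàro means.

The bounds on `s_n` follow from `b_n ≥ 2` and from `c_{n+1} / c_n ≤ 2 ^ (b_n - 1)`. The latter fails
only for `b_n = q_n = 2` with `r_n ≠ 0`, which forces `n = 2`; this is what the `-1` next to
`log₂ c_{n+1}` absorbs.
-/

namespace CoinSet

/-! ### Greedy representations and optimal costs -/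

theorem greatestCoin_eq {D : Set ℕ} {N d : ℕ} (hd : d ∈ D) (hdN : d ≤ N)
    (hmax : ∀ x ∈ D, x ≤ N → x ≤ d) : greatestCoin D N = d := by
  classical
  unfold greatestCoin
  rw [Nat.findGreatest_eq_iff]
  refine ⟨hdN, fun _ => hd, fun x hx hxN hxD => ?_⟩
  have := hmax x hxD hxN
  omega

theorem greedyRep_zero (D : Set ℕ) : greedyRep D 0 = 0 := by
  have h := greatestCoin_le D 0
  rw [greedyRep, if_neg (by omega)]

theorem card_greedyRep {D : Set ℕ} {N d : ℕ} (hd0 : 0 < d) (hd : d ∈ D) (hdN : d ≤ N)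
    (hmax : ∀ x ∈ D, x ≤ N → x ≤ d) :
    (greedyRep D N).card = (greedyRep D (N - d)).card + 1 := by
  have h := greatestCoin_eq hd hdN hmax
  rw [greedyRep, if_pos (by omega), h, Multiset.card_cons]

theorem opt_eq_card_of_isMinimalRep {C : Set ℕ} {N : ℕ} {m : Multiset ℕ}
    (h : IsMinimalRep C N m) : opt C N = m.card := by
  unfold opt
  apply le_antisymm
  · exact Nat.sInf_le ⟨m, h.1, rfl⟩
  · refine le_csInf ⟨m.card, m, h.1, rfl⟩ ?_
    rintro k ⟨m', hm', rfl⟩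
    exact h.2 m' hm'

theorem opt_zero (C : Set ℕ) : opt C 0 = 0 :=
  opt_eq_card_of_isMinimalRep (m := 0) ⟨⟨by simp, by simp⟩, by simp⟩

theorem opt_eq_card_greedyRep {D : Set ℕ} (hD : IsGreedy D) (N : ℕ) :
    opt D N = (greedyRep D N).card := by
  rcases Nat.eq_zero_or_pos N with rfl | hN
  · simp [opt_zero, greedyRep_zero]
  · exact opt_eq_card_of_isMinimalRep (hD N hN)

/-- Coins exceeding `N` play no role in the representations of `N`. -/
theorem opt_congr {C D : Set ℕ} {N : ℕ} (h : ∀ x ≤ N, x ∈ C ↔ x ∈ D) : opt C N = opt D N := by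
  have key : ∀ m : Multiset ℕ, IsRep C N m ↔ IsRep D N m := by
    intro m
    refine and_congr_left fun hs => forall₂_congr fun x hx => h x ?_
    rw [← hs]
    exact Multiset.le_sum_of_mem hx
  simp only [opt, key]

/-- In a coin set whose coins other than `1` are at least `A`, amounts below `A` are paid in
ones. -/
theorem card_greedyRep_of_lt {D : Set ℕ} {A : ℕ} (h1 : 1 ∈ D) (hD : ∀ x ∈ D, x = 1 ∨ A ≤ x)
    (k : ℕ) (hk : k < A) : (greedyRep D k).card = k := by
  induction k with
  | zero => simp [greedyRep_zero]
  | succ k ih =>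
    rw [card_greedyRep one_pos h1 (by omega), Nat.add_sub_cancel, ih (by omega)]
    intro x hx hxk
    rcases hD x hx with h | h <;> omega

/-! ### Coins of an infinite completely greedy set -/

section

variable {C : Set ℕ}

theorem coin_strictMono (hC : IsInfiniteCompletelyGreedy C) {m n : ℕ} (h : m < n) :
    coin C (m + 1) < coin C (n + 1) :=
  Nat.nth_strictMono hC.2.1 h

theorem coin_mem (hC : IsInfiniteCompletelyGreedy C) (n : ℕ) : coin C n ∈ C :=
  Nat.nth_mem_of_infinite hC.2.1 _

theorem coin_pos (hC : IsInfiniteCompletelyGreedy C) (n : ℕ) : 0 < coin C n :=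
  hC.1.2 _ (coin_mem hC n)

theorem coin_one (hC : IsInfiniteCompletelyGreedy C) : coin C 1 = 1 := by
  classical
  have h0 : (0 : ℕ) ∉ C := fun h => (hC.1.2 0 h).ne' rfl
  have h := Nat.nth_count (p := fun c => c ∈ C) hC.1.1
  rwa [Nat.count_succ, Nat.count_zero, if_neg h0] at h

/-- Below `c_{n+1}`, the coins of `C` are those among `c_1, …, c_n`. -/
theorem mem_iff_mem_image_coin (hC : IsInfiniteCompletelyGreedy C) {n x : ℕ}
    (hx : x < coin C (n + 1)) : x ∈ C ↔ x ∈ coin C '' Set.Icc 1 n := by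
  classical
  constructor
  · intro h
    have hc := Nat.nth_count (p := fun c => c ∈ C) h
    refine ⟨Nat.count (fun c => c ∈ C) x + 1, ⟨by omega, ?_⟩, hc⟩
    by_contra hlt
    have hle : n ≤ Nat.count (fun c => c ∈ C) x := by omega
    have h1 : coin C (n + 1) ≤ x := by
      rw [← hc]
      exact (Nat.nth_strictMono hC.2.1).monotone hle
    omega
  · rintro ⟨k, -, rfl⟩
    exact coin_mem hC k

theorem image_coin_isCoinSet (hC : IsInfiniteCompletelyGreedy C) (n : ℕ) :
    IsCoinSet (coin C '' Set.Icc 1 (n + 1)) := by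
  refine ⟨⟨1, ⟨le_rfl, by omega⟩, coin_one hC⟩, ?_⟩
  rintro _ ⟨k, -, rfl⟩
  exact coin_pos hC k

theorem opt_add_coin (hC : IsInfiniteCompletelyGreedy C) (n N : ℕ)
    (hN : N + coin C (n + 1) < coin C (n + 2)) :
    opt C (N + coin C (n + 1)) = opt C N + 1 := by
  have hg : IsGreedy (coin C '' Set.Icc 1 (n + 1)) :=
    hC.2.2 (n + 1) (by omega) _ subset_rfl (image_coin_isCoinSet hC n)
  have hmem : coin C (n + 1) ∈ coin C '' Set.Icc 1 (n + 1) := ⟨n + 1, ⟨by omega, le_rfl⟩, rfl⟩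
  rw [opt_congr (D := coin C '' Set.Icc 1 (n + 1))
      fun x hx => mem_iff_mem_image_coin hC (lt_of_le_of_lt hx hN : x < coin C (n + 2)),
    opt_congr (N := N) (D := coin C '' Set.Icc 1 (n + 1))
      fun x hx => mem_iff_mem_image_coin hC (show x < coin C (n + 2) by omega),
    opt_eq_card_greedyRep hg, opt_eq_card_greedyRep hg,
    card_greedyRep (coin_pos hC (n + 1)) hmem (by omega),
    Nat.add_sub_cancel]
  rintro _ ⟨k, ⟨hk1, hk2⟩, rfl⟩ -
  exact (Nat.nth_strictMono hC.2.1).monotone (Nat.sub_le_sub_right hk2 1)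

/-- The representation of `(q_n + 1) c_n` by `q_n + 1` coins `c_n` competes with the greedy one in
`{1, c_n, c_{n+1}}`, which uses `c_{n+1}` once and `1` for the rest. -/
theorem coin_defect_le (hC : IsInfiniteCompletelyGreedy C) (n : ℕ)
    (hr : coin C (n + 2) % coin C (n + 1) ≠ 0) :
    (coin C (n + 2) / coin C (n + 1) + 1) * coin C (n + 1) ≤
      coin C (n + 2) + coin C (n + 2) / coin C (n + 1) := by
  set A := coin C (n + 1) with hA
  set B := coin C (n + 2) with hB
  have hAB : A < B := coin_strictMono hC (Nat.lt_succ_self n)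
  have hA0 : 0 < A := coin_pos hC _
  have hrA : B % A < A := Nat.mod_lt _ hA0
  have hdiv : A * (B / A) + B % A = B := Nat.div_add_mod B A
  have hmul : (B / A + 1) * A = A * (B / A) + A := by ring
  let D : Set ℕ := {1, A, B}
  have hD : IsGreedy D := by
    refine hC.2.2 (n + 2) (by omega) D ?_ ⟨by simp [D], ?_⟩
    · rintro x (rfl | rfl | rfl)
      · exact (image_coin_isCoinSet hC (n + 1)).1
      · exact ⟨n + 1, ⟨by omega, by omega⟩, rfl⟩
      · exact ⟨n + 2, ⟨by omega, by omega⟩, rfl⟩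
    · rintro x (rfl | rfl | rfl) <;> omega
  have hmin := (hD ((B / A + 1) * A) (by omega)).2 (Multiset.replicate (B / A + 1) A)
    ⟨fun x hx => by simp [D, Multiset.eq_of_mem_replicate hx],
      by rw [Multiset.sum_replicate, smul_eq_mul]⟩
  rw [Multiset.card_replicate,
    card_greedyRep (d := B) (by omega) (by simp [D]) (by omega) ?_,
    card_greedyRep_of_lt (A := A) (by simp [D]) ?_ _ (by omega)] at hmin
  · omega
  · rintro x (rfl | rfl | rfl) <;> omega
  · rintro x (rfl | rfl | rfl) - <;> omega

theorem three_mul_coin_le (hC : IsInfiniteCompletelyGreedy C) (n : ℕ) :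
    3 * coin C (n + 1) ≤ 2 * coin C (n + 2) := by
  have hdef := coin_defect_le hC n
  have hAB : coin C (n + 1) < coin C (n + 2) := coin_strictMono hC (Nat.lt_succ_self n)
  have hA0 : 0 < coin C (n + 1) := coin_pos hC _
  generalize coin C (n + 1) = A at *
  generalize coin C (n + 2) = B at *
  have hdiv : A * (B / A) + B % A = B := Nat.div_add_mod B A
  have hrA : B % A < A := Nat.mod_lt _ hA0
  have hq : 1 ≤ B / A := Nat.div_pos hAB.le hA0
  rcases hq.eq_or_lt with hq1 | hq2
  · rw [← hq1] at hdiv hdef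
    have := hdef (by omega)
    omega
  · have : A * 2 ≤ A * (B / A) := Nat.mul_le_mul_left A hq2
    omega

theorem pow_le_coin (hC : IsInfiniteCompletelyGreedy C) (n : ℕ) :
    (3 / 2 : ℝ) ^ n ≤ coin C (n + 1) := by
  induction n with
  | zero => simp [coin_one hC]
  | succ n ih =>
    have h : (3 : ℝ) * coin C (n + 1) ≤ 2 * coin C (n + 2) := by
      exact_mod_cast three_mul_coin_le hC n
    rw [pow_succ]
    linarith

/-! ### The sums `s_n` -/

theorem q_succ (n : ℕ) : q C (n + 1) = ((coin C (n + 2) / coin C (n + 1) : ℕ) : ℤ) := by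
  simp [q]

theorem a_succ (hC : IsInfiniteCompletelyGreedy C) (n : ℕ) :
    a C (n + 1) = ((coin C (n + 2) / coin C (n + 1) : ℕ) : ℤ) +
      if coin C (n + 2) % coin C (n + 1) = 0 then 0 else 1 := by
  have hA0 : 0 < coin C (n + 1) := coin_pos hC _
  unfold a
  generalize coin C (n + 1) = A at *
  change ⌈((coin C (n + 2) : ℕ) : ℝ) / (A : ℝ)⌉ = _
  generalize coin C (n + 2) = B at *
  have hdiv : ((A * (B / A) + B % A : ℕ) : ℝ) = B := by rw [Nat.div_add_mod B A]
  have hrA : ((B % A : ℕ) : ℝ) < A := by exact_mod_cast Nat.mod_lt _ hA0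
  have hA : (0 : ℝ) < A := by exact_mod_cast hA0
  rw [Nat.cast_add, Nat.cast_mul] at hdiv
  rw [Int.ceil_eq_iff, lt_div_iff₀ hA, div_le_iff₀ hA]
  split_ifs with h
  · rw [h] at hdiv
    rw [Nat.cast_zero] at hdiv
    rw [Int.cast_add, Int.cast_natCast, Int.cast_zero]
    constructor <;> nlinarith
  · have hr : (1 : ℝ) ≤ ((B % A : ℕ) : ℝ) := by exact_mod_cast Nat.one_le_iff_ne_zero.2 h
    rw [Int.cast_add, Int.cast_natCast]
    rw [Int.cast_one]
    constructor <;> nlinarith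

/-- The two cases of `b_{n+1}`, with `b_1` placed in the first one, as `c_1 = 1`. -/
theorem bOf_cases (hC : IsInfiniteCompletelyGreedy C) (n : ℕ) (S : ℤ) :
    (bOf C (n + 1) S = ((coin C (n + 2) / coin C (n + 1) : ℕ) : ℤ) ∧
      (coin C (n + 2) % coin C (n + 1) = 0 ∨
        0 < n ∧ S < ((coin C (n + 2) / coin C (n + 1) : ℕ) : ℤ))) ∨
    (bOf C (n + 1) S = ((coin C (n + 2) / coin C (n + 1) : ℕ) : ℤ) + 1 ∧
      coin C (n + 2) % coin C (n + 1) ≠ 0 ∧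
        ((coin C (n + 2) / coin C (n + 1) : ℕ) : ℤ) ≤ S) := by
  have ha := a_succ hC n
  unfold bOf
  rw [q_succ]
  rcases Nat.eq_zero_or_pos n with rfl | hn
  · have hr : coin C (0 + 2) % coin C (0 + 1) = 0 := by
      rw [zero_add 1, coin_one hC, Nat.mod_one]
    left
    simp only [hr, if_true, add_zero] at ha
    simpa [hr] using ha
  · rw [if_neg (by omega)]
    by_cases hr : coin C (n + 2) % coin C (n + 1) = 0
    · left
      rw [if_pos hr, add_zero] at ha
      simp [hr, ha]
    · rw [if_neg hr] at ha
      split_ifs with hS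
      · exact Or.inr ⟨ha, hr, hS⟩
      · exact Or.inl ⟨rfl, Or.inr ⟨hn, by omega⟩⟩

theorem le_s (hC : IsInfiniteCompletelyGreedy C) (n : ℕ) : (n : ℤ) ≤ s C n := by
  induction n with
  | zero => simp [s]
  | succ n ih =>
    have hAB : coin C (n + 1) < coin C (n + 2) := coin_strictMono hC (Nat.lt_succ_self n)
    have hA0 : 0 < coin C (n + 1) := coin_pos hC _
    have hq : 1 ≤ coin C (n + 2) / coin C (n + 1) := Nat.div_pos hAB.le hA0
    have hb : 2 ≤ bOf C (n + 1) (s C n) := by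
      rcases bOf_cases hC n (s C n) with ⟨hb, hr | hS⟩ | ⟨hb, -⟩
      · have hdiv := Nat.div_add_mod (coin C (n + 2)) (coin C (n + 1))
        have : coin C (n + 2) / coin C (n + 1) ≠ 1 := by
          intro h
          rw [h, hr] at hdiv
          omega
        omega
      · omega
      · omega
    rw [s]
    push_cast
    omega

theorem natCast_le_two_zpow (m : ℕ) : (m : ℝ) ≤ 2 ^ ((m : ℤ) - 1) := by
  rcases Nat.eq_zero_or_pos m with rfl | hm
  · simp
  · obtain ⟨k, rfl⟩ : ∃ k, m = k + 1 := ⟨m - 1, by omega⟩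
    have h : (k : ℝ) + 1 ≤ 2 ^ k := by exact_mod_cast Nat.lt_two_pow_self (n := k)
    simpa using h

/-- The sharper bound for `n ≤ 1` is what the exceptional step `b_2 = q_2 = 2` needs. -/
theorem coin_le_two_zpow (hC : IsInfiniteCompletelyGreedy C) (n : ℕ) :
    (coin C (n + 1) : ℝ) ≤ 2 ^ (s C n + 1) ∧
      (n ≤ 1 → (coin C (n + 1) : ℝ) ≤ 2 ^ (s C n)) := by
  induction n with
  | zero => simp [s, coin_one hC]
  | succ n ih =>
    have hs := le_s hC n
    have hA0 : 0 < coin C (n + 1) := coin_pos hC _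
    have hrA := Nat.mod_lt (coin C (n + 2)) hA0
    have hdiv := Nat.div_add_mod (coin C (n + 2)) (coin C (n + 1))
    have hbc := bOf_cases hC n (s C n)
    -- A step with `c_{n+1} / c_n ≤ 2 ^ (b_n - 1)` preserves both bounds.
    have regular : (coin C (n + 2) : ℝ) ≤ coin C (n + 1) * 2 ^ (bOf C (n + 1) (s C n) - 1) →
        (coin C (n + 2) : ℝ) ≤ 2 ^ (s C (n + 1) + 1) ∧
          (n + 1 ≤ 1 → (coin C (n + 2) : ℝ) ≤ 2 ^ (s C (n + 1))) := by
      intro h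
      have hp : (0 : ℝ) < 2 ^ (bOf C (n + 1) (s C n) - 1) := by positivity
      refine ⟨h.trans ?_, fun hn => h.trans ?_⟩
      · rw [s, add_right_comm, zpow_add₀ two_ne_zero]
        exact mul_le_mul_of_nonneg_right ih.1 hp.le
      · rw [s, zpow_add₀ two_ne_zero]
        exact mul_le_mul_of_nonneg_right (ih.2 (by omega)) hp.le
    change (coin C (n + 2) : ℝ) ≤ 2 ^ (s C (n + 1) + 1) ∧
          (n + 1 ≤ 1 → (coin C (n + 2) : ℝ) ≤ 2 ^ (s C (n + 1)))
    generalize hA : coin C (n + 1) = A at *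
    generalize hB : coin C (n + 2) = B at *
    have hA' : (0 : ℝ) ≤ A := Nat.cast_nonneg A
    rcases hbc with ⟨hb, hcase⟩ | ⟨hb, -⟩
    · by_cases hr : B % A = 0
      · apply regular
        rw [hb]
        have hBA : (B : ℝ) = A * (B / A : ℕ) := by
          rw [hr] at hdiv
          exact_mod_cast hdiv.symm
        rw [hBA]
        exact mul_le_mul_of_nonneg_left (natCast_le_two_zpow _) hA'
      · obtain ⟨hn, hS⟩ := hcase.resolve_left hr
        have hBA : (B : ℝ) ≤ A * ((B / A : ℕ) + 1) := by
          have : B ≤ A * (B / A + 1) := by rw [mul_add]; omega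
          exact_mod_cast this
        by_cases hq : 3 ≤ B / A
        · apply regular
          refine hBA.trans ?_
          rw [hb]
          apply mul_le_mul_of_nonneg_left _ hA'
          obtain ⟨k, hk⟩ : ∃ k, B / A = k + 3 := ⟨B / A - 3, by omega⟩
          rw [hk]
          have h : (k : ℝ) + 1 ≤ 2 ^ k := by exact_mod_cast Nat.lt_two_pow_self (n := k)
          have he : ((k + 3 : ℕ) : ℤ) - 1 = ((k + 2 : ℕ) : ℤ) := by push_cast; ring
          rw [he, zpow_natCast, pow_add]
          push_cast
          have hk0 : (0 : ℝ) ≤ k := Nat.cast_nonneg k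
          linarith
        · -- Here `1 ≤ n ≤ s_n < q ≤ 2`, so this is the exceptional step.
          have hn1 : n = 1 := by omega
          have hs1 : s C n = 1 := by omega
          have hq2 : B / A = 2 := by omega
          refine ⟨?_, fun h => by omega⟩
          have hA2 := ih.2 hn1.le
          rw [s, hb, hs1, hq2]
          rw [hq2] at hBA
          rw [hs1] at hA2
          norm_num at hA2 hBA ⊢
          have hBA3 : B ≤ A * 3 := by exact_mod_cast hBA
          omega
    · apply regular
      have hBA : (B : ℝ) ≤ A * (B / A + 1 : ℕ) := by
        have : B ≤ A * (B / A + 1) := by rw [mul_add]; omega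
        exact_mod_cast this
      refine hBA.trans ?_
      rw [hb]
      exact mul_le_mul_of_nonneg_left (by exact_mod_cast natCast_le_two_zpow (B / A + 1)) hA'

/-! ### Block decomposition of the total cost -/

/-- The sum of `opt C k` over `k < N`, as a real number. -/
noncomputable def totalOpt (C : Set ℕ) (N : ℕ) : ℝ :=
  ∑ k ∈ Finset.range N, (opt C k : ℝ)

theorem totalOpt_nonneg (C : Set ℕ) (N : ℕ) : 0 ≤ totalOpt C N :=
  Finset.sum_nonneg fun _ _ => Nat.cast_nonneg _

theorem cost_eq_totalOpt {N : ℕ} (hN : 0 < N) : (cost C (N - 1) : ℝ) = totalOpt C N := by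
  obtain ⟨M, rfl⟩ : ∃ M, N = M + 1 := ⟨N - 1, by omega⟩
  rw [totalOpt, Finset.sum_range_succ', opt_zero, Nat.add_sub_cancel, cost, Nat.cast_sum,
    Finset.range_eq_Ico, Finset.sum_Ico_add' (fun k => (opt C k : ℝ)) 0 M 1]
  simp only [Nat.cast_zero, add_zero, zero_add]
  rfl

theorem totalOpt_coin_add (hC : IsInfiniteCompletelyGreedy C) (n N : ℕ)
    (hN : coin C (n + 1) + N ≤ coin C (n + 2)) :
    totalOpt C (coin C (n + 1) + N) = totalOpt C (coin C (n + 1)) + totalOpt C N + N := by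
  rw [totalOpt, Finset.sum_range_add, add_assoc]
  congr 1
  have h : ∀ k ∈ Finset.range N, (opt C (coin C (n + 1) + k) : ℝ) = opt C k + 1 := by
    intro k hk
    rw [Finset.mem_range] at hk
    rw [add_comm, opt_add_coin hC n k (by omega)]
    push_cast
    ring
  rw [Finset.sum_congr rfl h, Finset.sum_add_distrib]
  simp [totalOpt]

theorem totalOpt_block (hC : IsInfiniteCompletelyGreedy C) (n m t : ℕ)
    (h : coin C (n + 1) * m + t ≤ coin C (n + 2)) :
    totalOpt C (coin C (n + 1) * m + t) = m * totalOpt C (coin C (n + 1)) +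
      coin C (n + 1) * (m * (m - 1) / 2) + m * t + totalOpt C t := by
  induction m with
  | zero => simp
  | succ m ih =>
    rw [mul_add, mul_one, add_comm (coin C (n + 1) * m), add_assoc] at h ⊢
    rw [totalOpt_coin_add hC n _ h, ih (by omega)]
    push_cast
    ring

/-! ### Bounds by the sum of the ratios of consecutive coins -/

/-- The sum `∑_{k=1}^n c_{k+1} / c_k`. -/
noncomputable def ratioSum (C : Set ℕ) (n : ℕ) : ℝ :=
  ∑ k ∈ Finset.range n, (coin C (k + 2) : ℝ) / coin C (k + 1)

theorem ratioSum_succ (C : Set ℕ) (n : ℕ) :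
    ratioSum C (n + 1) = ratioSum C n + (coin C (n + 2) : ℝ) / coin C (n + 1) :=
  Finset.sum_range_succ _ _

theorem ratioSum_nonneg (C : Set ℕ) (n : ℕ) : 0 ≤ ratioSum C n :=
  Finset.sum_nonneg fun _ _ => by positivity

theorem s_le_ratioSum (hC : IsInfiniteCompletelyGreedy C) (n : ℕ) :
    (s C n : ℝ) ≤ ratioSum C n := by
  induction n with
  | zero => simp [s, ratioSum]
  | succ n ih =>
    have hq : ((coin C (n + 2) / coin C (n + 1) : ℕ) : ℝ) ≤
        (coin C (n + 2) : ℝ) / coin C (n + 1) := Nat.cast_div_le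
    have hb : bOf C (n + 1) (s C n) - 1 ≤ ((coin C (n + 2) / coin C (n + 1) : ℕ) : ℤ) := by
      rcases bOf_cases hC n (s C n) with ⟨hb, -⟩ | ⟨hb, -⟩ <;> omega
    have hb' : ((bOf C (n + 1) (s C n) - 1 : ℤ) : ℝ) ≤
        (((coin C (n + 2) / coin C (n + 1) : ℕ) : ℤ) : ℝ) := Int.cast_le.2 hb
    rw [Int.cast_natCast] at hb'
    rw [ratioSum_succ, s, Int.cast_add]
    linarith

theorem opt_le_ratioSum (hC : IsInfiniteCompletelyGreedy C) (n N : ℕ)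
    (hN : N < coin C (n + 1)) : (opt C N : ℝ) ≤ ratioSum C n := by
  induction n generalizing N with
  | zero =>
    rw [zero_add, coin_one hC, Nat.lt_one_iff] at hN
    simp [hN, opt_zero, ratioSum]
  | succ n ih =>
    have hA : (0 : ℝ) < coin C (n + 1) := by exact_mod_cast coin_pos hC _
    have key : ∀ N < coin C (n + 2),
        (opt C N : ℝ) ≤ ratioSum C n + (N : ℝ) / coin C (n + 1) := by
      intro N
      induction N using Nat.strong_induction_on with
      | _ N ihN =>
        intro hN
        by_cases h : N < coin C (n + 1)
        · have : (0 : ℝ) ≤ (N : ℝ) / coin C (n + 1) := by positivity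
          linarith [ih N h]
        · obtain ⟨M, rfl⟩ : ∃ M, N = M + coin C (n + 1) := ⟨N - coin C (n + 1), by omega⟩
          have h1 := ihN M (by have := coin_pos hC (n + 1); omega) (by omega)
          rw [opt_add_coin hC n M hN]
          push_cast
          rw [add_div, div_self hA.ne']
          linarith
    rw [ratioSum_succ]
    refine (key N hN).trans ?_
    gcongr

theorem ratioSum_div_coin_le (hC : IsInfiniteCompletelyGreedy C) (n : ℕ) :
    ratioSum C n / coin C (n + 1) ≤ 3 / 2 * (n * (2 / 3 : ℝ) ^ n) := by
  induction n with
  | zero => simp [ratioSum]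
  | succ n ih =>
    change ratioSum C (n + 1) / coin C (n + 2) ≤ _
    have hA : (0 : ℝ) < coin C (n + 1) := by exact_mod_cast coin_pos hC _
    have hB : (0 : ℝ) < coin C (n + 2) := by exact_mod_cast coin_pos hC _
    have hAB : (3 : ℝ) * coin C (n + 1) ≤ 2 * coin C (n + 2) := by
      exact_mod_cast three_mul_coin_le hC n
    have h1 : ratioSum C n / coin C (n + 2) ≤ 2 / 3 * (ratioSum C n / coin C (n + 1)) := by
      rw [← mul_div_assoc, div_le_div_iff₀ hB hA]
      nlinarith [ratioSum_nonneg C n]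
    have h2 : (1 : ℝ) / coin C (n + 1) ≤ (2 / 3) ^ n := by
      rw [div_le_iff₀ hA]
      calc (1 : ℝ) = (2 / 3) ^ n * (3 / 2) ^ n := by rw [← mul_pow]; norm_num
        _ ≤ _ := by gcongr; exact pow_le_coin hC n
    have h3 : ratioSum C (n + 1) / coin C (n + 2) =
        ratioSum C n / coin C (n + 2) + 1 / coin C (n + 1) := by
      rw [ratioSum_succ, add_div, div_right_comm, div_self hB.ne']
    rw [h3, pow_succ]
    push_cast
    linarith

theorem tendsto_ratioSum_div_coin (hC : IsInfiniteCompletelyGreedy C) :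
    Tendsto (fun n => ratioSum C n / coin C (n + 1)) atTop (nhds 0) := by
  have h := (tendsto_self_mul_const_pow_of_lt_one (r := (2 / 3 : ℝ)) (by norm_num)
    (by norm_num)).const_mul (3 / 2)
  rw [mul_zero] at h
  exact squeeze_zero (fun n => div_nonneg (ratioSum_nonneg C n) (Nat.cast_nonneg _))
    (ratioSum_div_coin_le hC) h

/-! ### The lower bound for the cost -/

/-- A bound for the accumulated relative loss in the lower bound for the cost. -/
noncomputable def lossBound (C : Set ℕ) (n : ℕ) : ℝ :=
  ∑ k ∈ Finset.range n, 2 * (ratioSum C k / coin C (k + 1))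

theorem lossBound_nonneg (C : Set ℕ) (n : ℕ) : 0 ≤ lossBound C n :=
  Finset.sum_nonneg fun k _ =>
    mul_nonneg zero_le_two (div_nonneg (ratioSum_nonneg C k) (Nat.cast_nonneg _))

theorem totalOpt_lower_bound (hC : IsInfiniteCompletelyGreedy C) (n : ℕ) :
    ((s C n : ℝ) / 2 - lossBound C n) * coin C (n + 1) ≤ totalOpt C (coin C (n + 1)) := by
  induction n with
  | zero => simp [s, lossBound, totalOpt_nonneg]
  | succ n ih =>
    change ((s C (n + 1) : ℝ) / 2 - lossBound C (n + 1)) * coin C (n + 2) ≤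
      totalOpt C (coin C (n + 2))
    have hs0 : (0 : ℝ) ≤ s C n := by exact_mod_cast (Nat.cast_nonneg n).trans (le_s hC n)
    have hsT := s_le_ratioSum hC n
    have hT := ratioSum_nonneg C n
    have hL := lossBound_nonneg C n
    have hF := totalOpt_nonneg C (coin C (n + 1))
    have hLs : lossBound C (n + 1) = lossBound C n + 2 * (ratioSum C n / coin C (n + 1)) :=
      Finset.sum_range_succ _ _
    have hA0 : 0 < coin C (n + 1) := coin_pos hC _
    have hrA := Nat.mod_lt (coin C (n + 2)) hA0
    have hdiv := Nat.div_add_mod (coin C (n + 2)) (coin C (n + 1))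
    have hblock := totalOpt_block hC n _ _ hdiv.le
    have hdef := coin_defect_le hC n
    have hopt := opt_le_ratioSum hC n
    rw [hdiv] at hblock
    have hbc := bOf_cases hC n (s C n)
    have hFr := totalOpt_nonneg C (coin C (n + 2) % coin C (n + 1))
    rw [hblock, hLs, s]
    generalize coin C (n + 1) = A at *
    generalize coin C (n + 2) = B at *
    have hdivR : (B : ℝ) = A * (B / A : ℕ) + (B % A : ℕ) := by exact_mod_cast hdiv.symm
    generalize hq : B / A = k at *
    generalize hr : B % A = r at *
    have hA : (0 : ℝ) < A := by exact_mod_cast hA0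
    have hr0 : (0 : ℝ) ≤ r := Nat.cast_nonneg r
    have hk0 : (0 : ℝ) ≤ k := Nat.cast_nonneg k
    rw [hdivR]
    have hkF := mul_le_mul_of_nonneg_left ih hk0
    have hTA : 0 ≤ ratioSum C n / A := by positivity
    rcases hbc with ⟨hb, hcase⟩ | ⟨hb, hr1, hkS⟩
    · rw [hb]
      push_cast
      have hgain : 0 ≤ ((k : ℝ) + 1 - s C n) * r := by
        rcases hcase with h | ⟨-, h⟩
        · simp [h]
        · have : (s C n : ℝ) < k := by exact_mod_cast h
          exact mul_nonneg (by linarith) hr0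
      have h1 : 0 ≤ lossBound C n * r := by positivity
      have h2 : 0 ≤ ratioSum C n / A * (A * k + r) := by positivity
      nlinarith
    · rw [hb]
      push_cast
      have hkS' : (k : ℝ) ≤ s C n := by exact_mod_cast hkS
      obtain ⟨d, rfl⟩ : ∃ d, A = r + d := ⟨A - r, by omega⟩
      -- `d` is the defect `(q + 1) A - B`.
      have hd : (d : ℝ) ≤ k := by
        have h := hdef hr1
        rw [← hdiv] at h
        have : d ≤ k := by nlinarith
        exact_mod_cast this
      have hd0 : (0 : ℝ) ≤ d := Nat.cast_nonneg d
      have hFd : totalOpt C (r + d) ≤ totalOpt C r + d * ratioSum C n := by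
        rw [totalOpt, Finset.sum_range_add]
        refine add_le_add le_rfl ?_
        calc _ ≤ ∑ _k ∈ Finset.range d, ratioSum C n :=
              Finset.sum_le_sum fun x hx => hopt _ (by
                rw [Finset.mem_range] at hx
                omega)
          _ = _ := by simp
      push_cast at *
      have hloss : (d : ℝ) * (k + ratioSum C n) ≤
          2 * (ratioSum C n / (r + d)) * ((r + d) * k + r) := by
        calc (d : ℝ) * (k + ratioSum C n) ≤ k * (2 * ratioSum C n) := by
              gcongr
              linarith
          _ = 2 * (ratioSum C n / (r + d)) * ((r + d) * k) := by
              field_simp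
          _ ≤ _ := by
              gcongr
              linarith
      have hmain : ((s C n : ℝ) / 2 - lossBound C n) * ((r + d) * k + r) ≤
          (k + 1) * totalOpt C (r + d) := by
        rw [← le_div_iff₀ hA] at ih
        calc _ ≤ totalOpt C (r + d) / (r + d) * ((r + d) * k + r) := by gcongr
          _ ≤ totalOpt C (r + d) / (r + d) * ((r + d) * (k + 1)) := by
              gcongr
              linarith
          _ = _ := by field_simp
      have hkd : 0 ≤ (k : ℝ) * d := by positivity
      linarith

end

end CoinSet

theorem mainTheorem6 (C : Set ℕ) (hC : CoinSet.IsInfiniteCompletelyGreedy C) :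
    (∃ g : ℕ → ℝ,
      g =o[atTop] (fun n : ℕ => (n : ℝ) * (CoinSet.coin C (n + 1) : ℝ)) ∧
      ∀ n : ℕ, 1 ≤ n →
        (CoinSet.cost C (CoinSet.coin C (n + 1) - 1) : ℝ) ≥
          (CoinSet.s C n : ℝ) / 2 * (CoinSet.coin C (n + 1) : ℝ) + g n) ∧
    ∀ n : ℕ, 1 ≤ n →
      (CoinSet.s C n : ℝ) ≥ max (n : ℝ) (Real.logb 2 (CoinSet.coin C (n + 1) : ℝ) - 1) := by
  have hpos : ∀ n, (0 : ℝ) < CoinSet.coin C (n + 1) := fun n => by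
    exact_mod_cast CoinSet.coin_pos hC _
  refine ⟨⟨fun n => -CoinSet.lossBound C n * CoinSet.coin C (n + 1), ?_, fun n _ => ?_⟩,
    fun n _ => max_le ?_ ?_⟩
  · refine IsLittleO.mul_isBigO ?_ (isBigO_refl _ _)
    rw [isLittleO_neg_left]
    rw [isLittleO_iff_tendsto' (by
      filter_upwards [eventually_gt_atTop 0] with n hn h
      exact absurd (Nat.cast_eq_zero.1 h) hn.ne')]
    have h := ((CoinSet.tendsto_ratioSum_div_coin hC).const_mul 2).cesaro
    rw [mul_zero] at h
    simpa only [CoinSet.lossBound, div_eq_inv_mul] using h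
  · rw [CoinSet.cost_eq_totalOpt (CoinSet.coin_pos hC _)]
    have h := CoinSet.totalOpt_lower_bound hC n
    linarith
  · exact_mod_cast CoinSet.le_s hC n
  · have h : Real.logb 2 (CoinSet.coin C (n + 1) : ℝ) ≤ ((CoinSet.s C n + 1 : ℤ) : ℝ) := by
      rw [Real.logb_le_iff_le_rpow one_lt_two (hpos n), Real.rpow_intCast]
      exact (CoinSet.coin_le_two_zpow hC n).1
    push_cast at h
    linarith
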